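/- Let $\alpha_1,\alpha_2,\beta_1,\beta_2>0$, and let $\{X(t):t\ge 0\}$ be a time-homogeneous continuous-time Markov chain on $\mathbb{Z}$ with transition probabilities $p_{k,n}(t)=P(X(t)=n\mid X(0)=k)$, $p_{k,n}(0)=1_{\{k=n\}}$, whose generator $g_{k,n}=\lim_{t\downarrow 0}\frac{p_{k,n}(t)-p_{k,n}(0)}{t}$ is given by $$g_{k,k+1}=\begin{cases}\alpha_1,&k\text{ even}\\ \beta_1,&k\text{ odd}\end{cases},\qquad g_{k,k-1}=\begin{cases}\alpha_2,&k\text{ even}\\ \beta_2,&k\text{ odd}\end{cases},\qquad g_{k,k}=\begin{cases}-(\alpha_1+\alpha_2),&k\text{ even}\\ -(\beta_1+\beta_2),&k\text{ odd}\end{cases},$$ and $g_{k,n}=0$ for $|k-n|\ge 2$. Put, for $z>0$ and $\gamma\in\mathbb{R}$, $$h(z)=\tfrac12\sqrt{(\alpha_1+\alpha_2-(\beta_1+\beta_2))^2z^2+4(\beta_1z^2+\beta_2)(\alpha_1z^2+\alpha_2)},\qquad \Lambda(\gamma)=\frac{h(e^\gamma)}{e^\gamma}-\frac{\alpha_1+\alpha_2+\beta_1+\beta_2}{2},$$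 and $\Lambda^*(y)=\sup_{\gamma\in\mathbb{R}}\{\gamma y-\Lambda(\gamma)\}\in[0,+\infty]$ for $y\in\mathbb{R}$. Then, for every $k\in\mathbb{Z}$ (with $P(X(0)=k)>0$, so that the conditional laws are defined), the family of laws $\pi_t=P\left(\frac{X(t)}{t}\in\cdot\,\Big|\,X(0)=k\right)$, $t>0$, satisfies the large deviation principle on $\mathbb{R}$ with speed function $v_t=t$ and good rate function $\Lambda^*$. That is, $\Lambda^*$ is nonnegative and lower semicontinuous, its level sets $\{y\in\mathbb{R}:\Lambda^*(y)\le\eta\}$, $\eta\ge 0$, are compact, and $$\liminf_{t\to+\infty}\frac1t\log\pi_t(O)\ge-\inf_{y\in O}\Lambda^*(y)\ \text{ for all open } O\subseteq\mathbb{R},\qquad \limsup_{t\to+\infty}\frac1t\log\pi_t(C)\le-\inf_{y\in C}\Lambda^*(y)\ \text{ for all closed } C\subseteq\mathbb{R},$$ with the conventions $\log 0=-\infty$ and $\inf\emptyset=+\infty$. -/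

import Mathlib

open MeasureTheory ProbabilityTheory Filter Topology
open scoped NNReal ENNReal

noncomputable section

/-! ### Large deviation principle -/

/-- The family of laws `π t` (`t > 0`) on a topological space `Y` satisfies the large deviation
principle as `t → ∞` with rate function `I : Y → [0, ∞]` and speed function `v`. All quantities
are extended reals, so that `log 0 = -∞` and the infimum over the empty set is `+∞`. -/
structure LargeDeviationPrinciple {Y : Type*} [TopologicalSpace Y] [MeasurableSpace Y]
    (π : ℝ≥0 → Measure Y) (v : ℝ≥0 → ℝ) (I : Y → EReal) : Prop where
  isProbabilityMeasure : ∀ t, 0 < t → IsProbabilityMeasure (π t)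
  speed_tendsto : Tendsto v atTop atTop
  rate_nonneg : ∀ y, 0 ≤ I y
  rate_lsc : LowerSemicontinuous I
  lower_bound : ∀ O : Set Y, IsOpen O →
    -(⨅ y ∈ O, I y) ≤ liminf (fun t => ((1 / v t : ℝ) : EReal) * ENNReal.log (π t O)) atTop
  upper_bound : ∀ C : Set Y, IsClosed C →
    limsup (fun t => ((1 / v t : ℝ) : EReal) * ENNReal.log (π t C)) atTop ≤ -(⨅ y ∈ C, I y)

/-- A rate function is good if all its level sets are compact. -/
def IsGoodRateFunction {Y : Type*} [TopologicalSpace Y] (I : Y → EReal) : Prop :=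
  ∀ η : ℝ, 0 ≤ η → IsCompact {y | I y ≤ (η : EReal)}

/-- The Legendre transform `y ↦ sup_γ (γ y - L γ)` on the real line, with values in the extended
reals. -/
def legendreTransform (L : ℝ → ℝ) (y : ℝ) : EReal :=
  ⨆ γ : ℝ, ((γ * y - L γ : ℝ) : EReal)

/-! ### Continuous-time Markov chains on the integers -/

/-- `p t k n` is the probability of going from `k` to `n` in time `t`: each `p t` is a stochastic
matrix, `p 0` is the identity matrix, and the Chapman-Kolmogorov equations hold. -/
structure IsTransitionFunction (p : ℝ≥0 → ℤ → ℤ → ℝ) : Prop where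
  nonneg : ∀ t k n, 0 ≤ p t k n
  hasSum_one : ∀ t k, HasSum (fun n => p t k n) 1
  zero : ∀ k n, p 0 k n = if k = n then 1 else 0
  chapman_kolmogorov : ∀ s t k n, HasSum (fun j => p s k j * p t j n) (p (s + t) k n)

/-- The matrix `g` is the generator of `p`: every entry `g k n` is the limit of
`(p t k n - p 0 k n) / t` as `t` decreases to `0`. -/
def HasGenerator (p : ℝ≥0 → ℤ → ℤ → ℝ) (g : ℤ → ℤ → ℝ) : Prop :=
  ∀ k n, Tendsto (fun t : ℝ≥0 => (p t k n - p 0 k n) / (t : ℝ)) (𝓝[>] 0) (𝓝 (g k n))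

/-- Under `P`, the process `X` is a time-homogeneous Markov chain on the integers with transition
function `p` (and arbitrary initial distribution): for times `t 0 < ... < t m`, states
`i 0, ..., i m`, a state `j` and a time lag `s`, the probability that `X (t m + s) = j` given
`X (t 0) = i 0, ..., X (t m) = i m` is `p s (i m) j`. This is written in product form, so that
conditioning events of probability zero impose nothing. -/
structure IsMarkovChain {Ω : Type*} [MeasurableSpace Ω] (P : Measure Ω)
    (X : ℝ≥0 → Ω → ℤ) (p : ℝ≥0 → ℤ → ℤ → ℝ) : Prop where
  measurable : ∀ t, Measurable (X t)
  markov : ∀ (m : ℕ) (t : Fin (m + 1) → ℝ≥0), StrictMono t →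
    ∀ (i : Fin (m + 1) → ℤ) (s : ℝ≥0) (j : ℤ),
      P ({ω | ∀ l, X (t l) ω = i l} ∩ {ω | X (t (Fin.last m) + s) ω = j}) =
        P {ω | ∀ l, X (t l) ω = i l} * ENNReal.ofReal (p s (i (Fin.last m)) j)

/-! ### The chain with alternating rates -/

/-- The generator of the nearest-neighbour chain with alternating rates: from an even state the
rates up and down are `α₁` and `α₂`, from an odd state they are `β₁` and `β₂`. -/
def alternatingGenerator (α₁ α₂ β₁ β₂ : ℝ) (k n : ℤ) : ℝ :=
  if n = k + 1 then (if Even k then α₁ else β₁)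
  else if n = k - 1 then (if Even k then α₂ else β₂)
  else if n = k then (if Even k then -(α₁ + α₂) else -(β₁ + β₂))
  else 0

/-- The function under the square root in the definition of `alternatingH`. -/
def alternatingHTilde (α₁ α₂ β₁ β₂ z : ℝ) : ℝ :=
  (α₁ + α₂ - (β₁ + β₂)) ^ 2 * z ^ 2 + 4 * (β₁ * z ^ 2 + β₂) * (α₁ * z ^ 2 + α₂)

/-- The function `h`. -/
def alternatingH (α₁ α₂ β₁ β₂ z : ℝ) : ℝ :=
  1 / 2 * Real.sqrt (alternatingHTilde α₁ α₂ β₁ β₂ z)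

/-- The function `Λ`, given by `Λ γ = h (e ^ γ) / e ^ γ - (α₁ + α₂ + β₁ + β₂) / 2`. -/
def alternatingLambda (α₁ α₂ β₁ β₂ γ : ℝ) : ℝ :=
  alternatingH α₁ α₂ β₁ β₂ (Real.exp γ) / Real.exp γ - (α₁ + α₂ + β₁ + β₂) / 2

end

/-! The generator has positive eigenfunctions `f n = c n * exp (γ * n)`, with `c n` depending only
on the parity of `n`. The eigenvalue equation reduces to a 2 × 2 system whose larger characteristic
root is `Λ γ`. If the semigroup acts on `f` by `exp (t * Λ γ)`, then, since `f n` and `exp (γ * n)`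
agree up to constant factors, so do the moment generating function of `X t` and `exp (t * Λ γ)`
(`exists_tsum_mul_exp_bounds`).

Passing from generator to semigroup needs care, because only derivatives at time 0 are given and `f`
is unbounded. Choose `c` so that `g + c` has nonnegative entries. Discarding terms in
Chapman-Kolmogorov shows that `exp (c * t) * p t` dominates the exponential series of `g + c`. Both
have row sums `exp (c * t)`, so they are equal (`IsTransitionFunction.tsum_uniformizedPow_eq`), and
the series can be applied to `f` by Tonelli.

The rest is Gärtner-Ellis: a Chernoff bound with compactness for closed sets, exponential tilting
for open sets. As `Λ` is differentiable and `Λ γ - γ * y` is coercive in `γ`, every real `y` is a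
value of `Λ'`, so tilting reaches every point. -/

/-! ### Transition functions of birth-death chains with bounded rates -/

/-- The operator `g + c` for a tridiagonal matrix `g`. -/
def uniformizedStep (g : ℤ → ℤ → ℝ) (c : ℝ) (f : ℤ → ℝ) (k : ℤ) : ℝ :=
  g k (k + 1) * f (k + 1) + g k (k - 1) * f (k - 1) + (c + g k k) * f k

/-- The entries of the powers of `g + c` for a tridiagonal matrix `g`. -/
def uniformizedPow (g : ℤ → ℤ → ℝ) (c : ℝ) (m : ℕ) (k n : ℤ) : ℝ :=
  (uniformizedStep g c)^[m] (fun j => if j = n then 1 else 0) k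

theorem uniformizedPow_zero (g : ℤ → ℤ → ℝ) (c : ℝ) (k n : ℤ) :
    uniformizedPow g c 0 k n = if k = n then 1 else 0 := rfl

theorem uniformizedPow_succ (g : ℤ → ℤ → ℝ) (c : ℝ) (m : ℕ) (k n : ℤ) :
    uniformizedPow g c (m + 1) k n = uniformizedStep g c (fun j => uniformizedPow g c m j n) k := by
  unfold uniformizedPow
  rw [Function.iterate_succ_apply']

/-- The tridiagonal matrix `g` has nonnegative off-diagonal entries and its diagonal entries are at
least `-c`. -/
structure HasRatesLE (g : ℤ → ℤ → ℝ) (c : ℝ) : Prop where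
  up : ∀ k, 0 ≤ g k (k + 1)
  down : ∀ k, 0 ≤ g k (k - 1)
  diag : ∀ k, 0 ≤ c + g k k

theorem HasRatesLE.step_mono {g : ℤ → ℤ → ℝ} {c : ℝ} (h : HasRatesLE g c) {f₁ f₂ : ℤ → ℝ}
    (hf : ∀ k, f₁ k ≤ f₂ k) (k : ℤ) : uniformizedStep g c f₁ k ≤ uniformizedStep g c f₂ k := by
  unfold uniformizedStep
  have := mul_le_mul_of_nonneg_left (hf (k + 1)) (h.up k)
  have := mul_le_mul_of_nonneg_left (hf (k - 1)) (h.down k)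
  have := mul_le_mul_of_nonneg_left (hf k) (h.diag k)
  linarith

theorem HasRatesLE.step_nonneg {g : ℤ → ℤ → ℝ} {c : ℝ} (h : HasRatesLE g c) {f : ℤ → ℝ}
    (hf : ∀ k, 0 ≤ f k) (k : ℤ) : 0 ≤ uniformizedStep g c f k := by
  simpa [uniformizedStep] using h.step_mono (f₁ := fun _ => 0) hf k

theorem HasRatesLE.pow_nonneg {g : ℤ → ℤ → ℝ} {c : ℝ} (h : HasRatesLE g c) (m : ℕ) (k n : ℤ) :
    0 ≤ uniformizedPow g c m k n := by
  induction m generalizing k with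
  | zero => rw [uniformizedPow_zero]; split_ifs <;> norm_num
  | succ m ih => rw [uniformizedPow_succ]; exact h.step_nonneg ih k

/-- Powers of `g + c` act on an eigenfunction by powers of the eigenvalue. -/
theorem hasSum_uniformizedPow_mul {g : ℤ → ℤ → ℝ} {c r : ℝ} {f : ℤ → ℝ}
    (hf : ∀ k, uniformizedStep g c f k = r * f k) (m : ℕ) (k : ℤ) :
    HasSum (fun n => uniformizedPow g c m k n * f n) (r ^ m * f k) := by
  induction m generalizing k with
  | zero =>
    simp only [uniformizedPow_zero, pow_zero, one_mul]
    have := hasSum_single (f := fun n => (if k = n then (1 : ℝ) else 0) * f n) k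
      (fun n hn => by simp [hn.symm])
    simpa using this
  | succ m ih =>
    have := ((((ih (k + 1)).mul_left (g k (k + 1))).add ((ih (k - 1)).mul_left (g k (k - 1)))).add
      ((ih k).mul_left (c + g k k)))
    convert! this using 1
    · funext n
      rw [uniformizedPow_succ, uniformizedStep]
      ring
    · rw [pow_succ, mul_assoc, ← hf k, uniformizedStep]
      ring

/-! ### Continuity in time and domination of the exponential series -/

namespace IsTransitionFunction

variable {p : ℝ≥0 → ℤ → ℤ → ℝ}

theorem le_one (hp : IsTransitionFunction p) (t : ℝ≥0) (k n : ℤ) : p t k n ≤ 1 :=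
  le_hasSum (hp.hasSum_one t k) n fun j _ => hp.nonneg t k j

/-- By Chapman-Kolmogorov, `1 - p (s + t) k n` is the sum of `p s k j * (1 - p t j n)` over `j`;
keep only `j = k`. -/
theorem add_sub_le (hp : IsTransitionFunction p) (s t : ℝ≥0) (k n : ℤ) :
    p (s + t) k n - p t k n ≤ 1 - p s k k := by
  have h1 := hp.chapman_kolmogorov s t k n
  have h2 := (hp.hasSum_one s k).sub h1
  have h3 := le_hasSum h2 k fun j _ => by
    have := mul_le_mul_of_nonneg_left (hp.le_one t j n) (hp.nonneg s k j)
    linarith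
  have := mul_nonneg (sub_nonneg.2 (hp.le_one s k k)) (hp.nonneg t k n)
  linarith

/-- Chapman-Kolmogorov with three terms kept. Settling for an inequality avoids exchanging the limit
at time 0 with an infinite sum. -/
theorem mul_le_add (hp : IsTransitionFunction p) (s t : ℝ≥0) (k n : ℤ) :
    p s k (k + 1) * p t (k + 1) n + p s k (k - 1) * p t (k - 1) n + p s k k * p t k n
      ≤ p (s + t) k n := by
  have h := sum_le_hasSum ({k + 1, k - 1, k} : Finset ℤ)
    (fun j _ => mul_nonneg (hp.nonneg s k j) (hp.nonneg t j n)) (hp.chapman_kolmogorov s t k n)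
  rw [Finset.sum_insert, Finset.sum_insert, Finset.sum_singleton] at h
  · linarith
  · simp
  · simp; omega

/-- The bound does not depend on `t` or `n`, so continuity of `p · k k` at 0 gives continuity at all
times. -/
theorem abs_add_sub_le (hp : IsTransitionFunction p) (s t : ℝ≥0) (k n : ℤ) :
    |p (s + t) k n - p t k n| ≤ 1 - p s k k := by
  refine abs_le.2 ⟨?_, hp.add_sub_le s t k n⟩
  have h1 := hp.mul_le_add s t k n
  have h2 := mul_nonneg (hp.nonneg s k (k + 1)) (hp.nonneg t (k + 1) n)
  have h3 := mul_nonneg (hp.nonneg s k (k - 1)) (hp.nonneg t (k - 1) n)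
  have h4 := mul_nonneg (sub_nonneg.2 (hp.le_one s k k)) (sub_nonneg.2 (hp.le_one t k n))
  linarith

theorem tendsto_diag {g : ℤ → ℤ → ℝ} (hp : IsTransitionFunction p) (hg : HasGenerator p g)
    (k : ℤ) : Tendsto (fun s => p s k k) (𝓝 0) (𝓝 1) := by
  have h0 : p 0 k k = 1 := by simp [hp.zero]
  have h1 : Tendsto (fun t : ℝ≥0 => (t : ℝ)) (𝓝[>] 0) (𝓝 0) := by
    have : ContinuousAt (fun t : ℝ≥0 => (t : ℝ)) 0 := NNReal.continuous_coe.continuousAt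
    exact this.tendsto.mono_left nhdsWithin_le_nhds
  have h2 := ((hg k k).mul h1).add_const 1
  rw [mul_zero, zero_add] at h2
  have h3 : Tendsto (fun s => p s k k) (𝓝[>] 0) (𝓝 1) := by
    refine h2.congr' ?_
    filter_upwards [self_mem_nhdsWithin] with t ht
    have : (t : ℝ) ≠ 0 := by simpa using (ne_of_gt ht)
    rw [div_mul_cancel₀ _ this, h0]
    ring
  have h4 : ContinuousWithinAt (fun s => p s k k) (Set.Ioi 0) 0 := by
    simpa [ContinuousWithinAt, h0] using h3
  have h5 := h4.insert
  have : insert (0 : ℝ≥0) (Set.Ioi 0) = Set.univ := by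
    ext x; simp
  rw [this, continuousWithinAt_univ] at h5
  simpa [ContinuousAt, h0] using h5

theorem continuous {g : ℤ → ℤ → ℝ} (hp : IsTransitionFunction p) (hg : HasGenerator p g)
    (k n : ℤ) : Continuous fun t => p t k n := by
  have key : ∀ s t : ℝ≥0, dist (p s k n) (p t k n) ≤ 1 - p (nndist s t) k k := by
    have aux : ∀ s t : ℝ≥0, s ≤ t → dist (p s k n) (p t k n) ≤ 1 - p (nndist s t) k k := by
      intro s t hst
      have h := hp.abs_add_sub_le (t - s) s k n
      rw [tsub_add_cancel_of_le hst] at h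
      have hd : nndist s t = t - s := by
        apply NNReal.coe_injective
        rw [coe_nndist, NNReal.dist_eq, NNReal.coe_sub hst, abs_sub_comm, abs_of_nonneg]
        exact sub_nonneg.2 (by exact_mod_cast hst)
      rw [hd, dist_comm, Real.dist_eq]
      exact h
    intro s t
    rcases le_total s t with h | h
    · exact aux s t h
    · rw [dist_comm, nndist_comm]; exact aux t s h
  refine continuous_iff_continuousAt.2 fun t => ?_
  refine tendsto_iff_dist_tendsto_zero.2 ?_
  have h1 : Tendsto (fun s : ℝ≥0 => nndist s t) (𝓝 t) (𝓝 0) := by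
    have : Continuous fun s : ℝ≥0 => nndist s t := by fun_prop
    simpa using this.tendsto t
  have h2 := ((hp.tendsto_diag hg k).comp h1).const_sub 1
  rw [sub_self] at h2
  exact squeeze_zero (fun _ => dist_nonneg) (fun s => key s t) h2

/-- A lower bound for the right difference quotients of `exp (c x) * p x k n`. -/
theorem eventually_lt_slope {g : ℤ → ℤ → ℝ} (hp : IsTransitionFunction p) (hg : HasGenerator p g)
    (c : ℝ) (k n : ℤ) {x r : ℝ} (hx : 0 ≤ x)
    (hr : r < uniformizedStep g c (fun j => Real.exp (c * x) * p x.toNNReal j n) k) :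
    ∀ᶠ z in 𝓝[>] x, r < slope (fun z => Real.exp (c * z) * p z.toNNReal k n) x z := by
  have hlim : Tendsto (fun z : ℝ => (z - x).toNNReal) (𝓝[>] x) (𝓝[>] 0) := by
    refine tendsto_nhdsWithin_iff.2 ⟨?_, ?_⟩
    · have : Continuous fun z : ℝ => (z - x).toNNReal := by fun_prop
      have h := this.tendsto x
      simp only [sub_self, Real.toNNReal_zero] at h
      exact h.mono_left nhdsWithin_le_nhds
    · filter_upwards [self_mem_nhdsWithin] with z hz
      simpa using hz
  have hexp : Tendsto (fun z => Real.exp (c * z)) (𝓝[>] x) (𝓝 (Real.exp (c * x))) := by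
    have : Continuous fun z : ℝ => Real.exp (c * z) := by fun_prop
    exact (this.tendsto x).mono_left nhdsWithin_le_nhds
  have hslope : Tendsto (slope (fun z => Real.exp (c * z)) x) (𝓝[>] x)
      (𝓝 (Real.exp (c * x) * c)) := by
    have h : HasDerivAt (fun z => Real.exp (c * z)) (Real.exp (c * x) * c) x := by
      simpa using ((hasDerivAt_id x).const_mul c).exp
    exact (hasDerivAt_iff_tendsto_slope.1 h).mono_left
      (nhdsWithin_mono _ fun z hz => ne_of_gt hz)
  set q : ℤ → ℝ := fun j => p x.toNNReal j n
  -- Product rule: the limit is the value of `uniformizedStep`, the slope of the exponential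
  -- contributing the term with `c`.
  have hG := (hexp.mul (((((hg k (k + 1)).comp hlim).mul_const (q (k + 1))).add
    (((hg k (k - 1)).comp hlim).mul_const (q (k - 1)))).add
    (((hg k k).comp hlim).mul_const (q k)))).add (hslope.mul_const (q k))
  have hr' : r < Real.exp (c * x) * (g k (k + 1) * q (k + 1) + g k (k - 1) * q (k - 1)
      + g k k * q k) + Real.exp (c * x) * c * q k := by
    refine hr.trans_eq ?_
    simp only [uniformizedStep, q]
    ring
  filter_upwards [hG.eventually_const_lt hr', self_mem_nhdsWithin] with z hz hxz
  refine hz.trans_le ?_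
  have hpos : 0 < z - x := sub_pos.2 hxz
  have hadd : (z - x).toNNReal + x.toNNReal = z.toNNReal := by
    rw [← Real.toNNReal_add hpos.le hx, sub_add_cancel]
  have h := hp.mul_le_add (z - x).toNNReal x.toNNReal k n
  rw [hadd] at h
  simp only [Function.comp, hp.zero, Real.coe_toNNReal _ hpos.le, slope_def_field]
  rw [if_neg (by omega), if_neg (by omega), if_pos trivial]
  have h' := mul_le_mul_of_nonneg_left h (Real.exp_pos (c * z)).le
  rw [← sub_nonneg]
  -- The slope exceeds the expression in `hG` by `exp (c * z) / (z - x)` times the discarded part of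
  -- Chapman-Kolmogorov.
  have e : ∀ a b d e w : ℝ, (Real.exp (c * z) * w - e) / (z - x) -
      (Real.exp (c * z) * ((a - 0) / (z - x) * q (k + 1) + (b - 0) / (z - x) * q (k - 1) +
        (d - 1) / (z - x) * q k) + (Real.exp (c * z) - Real.exp (c * x)) / (z - x) * q k)
      = (Real.exp (c * z) * w - Real.exp (c * z) * (a * q (k + 1) + b * q (k - 1) + d * q k)
        + (Real.exp (c * x) * q k - e)) / (z - x) := by
    intros; field_simp; ring
  rw [e]
  refine div_nonneg ?_ hpos.le
  simp only [q]
  linarith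

/-- Induction on the truncation: the derivative of the longer partial sum is `uniformizedStep` of
the shorter one. The lower right derivative of `exp (c * x) * p` is at least `uniformizedStep` of
itself, and this operator is monotone. -/
theorem sum_uniformizedPow_le {g : ℤ → ℤ → ℝ} {c : ℝ} (hp : IsTransitionFunction p)
    (hg : HasGenerator p g) (hc : HasRatesLE g c) (M : ℕ) {x : ℝ} (hx : 0 ≤ x) (k n : ℤ) :
    ∑ m ∈ Finset.range M, x ^ m / m.factorial * uniformizedPow g c m k n
      ≤ Real.exp (c * x) * p x.toNNReal k n := by
  induction M generalizing x k with
  | zero => simpa using mul_nonneg (Real.exp_pos _).le (hp.nonneg _ k n)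
  | succ M ih =>
    have hderiv : ∀ y : ℝ, HasDerivAt
        (fun x : ℝ => ∑ m ∈ Finset.range (M + 1), x ^ m / m.factorial * uniformizedPow g c m k n)
        (∑ m ∈ Finset.range M, y ^ m / m.factorial * uniformizedPow g c (m + 1) k n) y := by
      intro y
      simp only [Finset.sum_range_succ' _ M, pow_zero]
      refine (HasDerivAt.fun_sum fun m _ => ?_).add_const _
      refine HasDerivAt.mul_const ?_ _
      refine ((hasDerivAt_pow (m + 1) y).div_const _).congr_deriv ?_
      rw [Nat.factorial_succ]
      have : (m.factorial : ℝ) ≠ 0 := by positivity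
      push_cast
      field_simp
    have hcont : Continuous fun z : ℝ => Real.exp (c * z) * p z.toNNReal k n := by
      have := (hp.continuous hg k n).comp continuous_real_toNNReal
      exact (by fun_prop : Continuous fun z : ℝ => Real.exp (c * z)).mul this
    -- The comparison principle yields upper bounds, so both sides are negated; they agree at time
    -- 0.
    have hmain := image_le_of_liminf_slope_right_le_deriv_boundary (a := 0) (b := x)
      (f := fun z => -(Real.exp (c * z) * p z.toNNReal k n)) hcont.neg.continuousOn
      (B := fun x => -∑ m ∈ Finset.range (M + 1),
        x ^ m / m.factorial * uniformizedPow g c m k n)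
      (B' := fun y => -∑ m ∈ Finset.range M,
        y ^ m / m.factorial * uniformizedPow g c (m + 1) k n)
      (by simp [Finset.sum_range_succ', uniformizedPow_zero, hp.zero])
      (fun y _ => (hderiv y).continuousAt.neg.continuousWithinAt)
      (fun y _ => (hderiv y).neg.hasDerivWithinAt)
      (fun y hy r hr => by
        have hstep : ∑ m ∈ Finset.range M, y ^ m / m.factorial * uniformizedPow g c (m + 1) k n
            = uniformizedStep g c (fun j => ∑ m ∈ Finset.range M,
              y ^ m / m.factorial * uniformizedPow g c m j n) k := by
          simp only [uniformizedStep, Finset.mul_sum, ← Finset.sum_add_distrib]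
          refine Finset.sum_congr rfl fun m _ => ?_
          rw [uniformizedPow_succ, uniformizedStep]
          ring
        have hle := hc.step_mono (fun j => ih hy.1 j) k
        rw [← hstep] at hle
        refine ((hp.eventually_lt_slope hg c k n hy.1 (r := -r) (by linarith)).mono
          fun z hz => ?_).frequently
        rw [slope_def_field] at hz ⊢
        have : (-(Real.exp (c * z) * p z.toNNReal k n)
          - -(Real.exp (c * y) * p y.toNNReal k n)) / (z - y) =
          -((Real.exp (c * z) * p z.toNNReal k n - Real.exp (c * y) * p y.toNNReal k n) / (z - y))
          := by ring
        rw [this]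
        linarith)
      (Set.right_mem_Icc.2 hx)
    simpa using hmain

end IsTransitionFunction

/-- All terms are nonnegative, so Tonelli allows summing over `n` first, which leaves the series of
`exp (r * x)`. -/
theorem tsum_ofReal_uniformizedPow_mul {g : ℤ → ℤ → ℝ} {c r : ℝ} {f : ℤ → ℝ}
    (hc : HasRatesLE g c) (hf0 : ∀ k, 0 ≤ f k) (hr : 0 ≤ r)
    (hf : ∀ k, uniformizedStep g c f k = r * f k) {x : ℝ} (hx : 0 ≤ x) (k : ℤ) :
    ∑' n, (∑' m : ℕ, ENNReal.ofReal (x ^ m / m.factorial * uniformizedPow g c m k n))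
        * ENNReal.ofReal (f n) = ENNReal.ofReal (Real.exp (r * x) * f k) := by
  have hnn : ∀ (m : ℕ) n, 0 ≤ x ^ m / m.factorial * uniformizedPow g c m k n := fun m n =>
    mul_nonneg (by positivity) (hc.pow_nonneg m k n)
  simp only [← ENNReal.tsum_mul_right, ← ENNReal.ofReal_mul (hnn _ _)]
  rw [ENNReal.tsum_comm]
  have h1 : ∀ m : ℕ, ∑' n, ENNReal.ofReal
      (x ^ m / m.factorial * uniformizedPow g c m k n * f n)
      = ENNReal.ofReal ((r * x) ^ m / m.factorial * f k) := by
    intro m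
    have h := (hasSum_uniformizedPow_mul hf m k).mul_left (x ^ m / (m.factorial : ℝ))
    simp only [← mul_assoc] at h
    rw [← ENNReal.ofReal_tsum_of_nonneg (fun n => mul_nonneg (hnn m n) (hf0 n)) h.summable,
      h.tsum_eq]
    congr 1
    ring
  simp only [h1]
  have h2 : HasSum (fun m : ℕ => (r * x) ^ m / m.factorial * f k) (Real.exp (r * x) * f k) := by
    refine HasSum.mul_right _ ?_
    rw [Real.exp_eq_exp_ℝ]
    exact NormedSpace.expSeries_div_hasSum_exp (r * x)
  rw [← ENNReal.ofReal_tsum_of_nonneg (fun m => ?_) h2.summable, h2.tsum_eq]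
  have := mul_nonneg hr hx
  have := hf0 k
  positivity

/-- A transition function with a bounded conservative tridiagonal generator is given by the
exponential series. -/
theorem IsTransitionFunction.tsum_uniformizedPow_eq {p : ℝ≥0 → ℤ → ℤ → ℝ} {g : ℤ → ℤ → ℝ} {c : ℝ}
    (hp : IsTransitionFunction p) (hg : HasGenerator p g) (hc : HasRatesLE g c) (hc0 : 0 ≤ c)
    (hsum : ∀ k, g k (k + 1) + g k (k - 1) + g k k = 0) (t : ℝ≥0) (k n : ℤ) :
    ∑' m : ℕ, ENNReal.ofReal ((t : ℝ) ^ m / m.factorial * uniformizedPow g c m k n)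
      = ENNReal.ofReal (Real.exp (c * t) * p t k n) := by
  set F : ℤ → ℝ≥0∞ := fun n =>
    ∑' m : ℕ, ENNReal.ofReal ((t : ℝ) ^ m / m.factorial * uniformizedPow g c m k n)
  set G : ℤ → ℝ≥0∞ := fun n => ENNReal.ofReal (Real.exp (c * t) * p t k n)
  have hle : ∀ n, F n ≤ G n := by
    intro n
    refine ENNReal.tsum_le_of_sum_range_le fun M => ?_
    rw [← ENNReal.ofReal_sum_of_nonneg fun m _ =>
      mul_nonneg (by positivity) (hc.pow_nonneg m k n)]
    have := hp.sum_uniformizedPow_le hg hc M t.2 k n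
    refine ENNReal.ofReal_le_ofReal ?_
    simpa using this
  -- The rows of `g` sum to 0, so the constant 1 is an eigenfunction of `g + c` with eigenvalue `c`.
  have hF : ∑' n, F n = ENNReal.ofReal (Real.exp (c * t)) := by
    have := tsum_ofReal_uniformizedPow_mul (f := fun _ => 1) (r := c) hc (fun _ => zero_le_one)
      hc0 (fun k => by simp only [uniformizedStep]; linarith [hsum k]) t.2 k
    simpa using this
  have hG : ∑' n, G n = ENNReal.ofReal (Real.exp (c * t)) := by
    have h := (hp.hasSum_one t k).mul_left (Real.exp (c * t))
    rw [mul_one] at h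
    rw [← ENNReal.ofReal_tsum_of_nonneg (fun n => ?_) h.summable, h.tsum_eq]
    exact mul_nonneg (Real.exp_pos _).le (hp.nonneg t k n)
  -- Given `F ≤ G` termwise, a strict inequality at one `n` would contradict the equal finite
  -- totals.
  by_contra hne
  have hlt : F n < G n := lt_of_le_of_ne (hle n) hne
  have := ENNReal.tsum_lt_tsum (hF ▸ ENNReal.ofReal_ne_top) hle hlt
  rw [hF, hG] at this
  exact lt_irrefl _ this

/-- Nonnegative eigenfunctions of the generator are eigenfunctions of the semigroup. -/
theorem IsTransitionFunction.tsum_mul_eigenfunction {p : ℝ≥0 → ℤ → ℤ → ℝ} {g : ℤ → ℤ → ℝ} {c l : ℝ}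
    (hp : IsTransitionFunction p) (hg : HasGenerator p g) (hc : HasRatesLE g c) (hc0 : 0 ≤ c)
    (hsum : ∀ k, g k (k + 1) + g k (k - 1) + g k k = 0) {f : ℤ → ℝ} (hf0 : ∀ k, 0 ≤ f k)
    (hl : 0 ≤ c + l)
    (hf : ∀ k, g k (k + 1) * f (k + 1) + g k (k - 1) * f (k - 1) + g k k * f k = l * f k)
    (t : ℝ≥0) (k : ℤ) :
    ∑' n, ENNReal.ofReal (p t k n) * ENNReal.ofReal (f n)
      = ENNReal.ofReal (Real.exp (l * t) * f k) := by
  have h := tsum_ofReal_uniformizedPow_mul (f := f) (r := c + l) hc hf0 hl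
    (fun k => by simp only [uniformizedStep]; linarith [hf k]) t.2 k
  have h1 : ∀ n, ∑' m : ℕ, ENNReal.ofReal ((t : ℝ) ^ m / m.factorial * uniformizedPow g c m k n)
      = ENNReal.ofReal (Real.exp (c * t)) * ENNReal.ofReal (p t k n) := fun n => by
    rw [hp.tsum_uniformizedPow_eq hg hc hc0 hsum, ENNReal.ofReal_mul (Real.exp_pos _).le]
  have h2 : ∑' n, ENNReal.ofReal (Real.exp (c * t)) *
      (ENNReal.ofReal (p t k n) * ENNReal.ofReal (f n))
      = ENNReal.ofReal (Real.exp (c * t)) * ENNReal.ofReal (Real.exp (l * t) * f k) := by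
    rw [← ENNReal.ofReal_mul (Real.exp_pos _).le, ← mul_assoc (Real.exp _), ← Real.exp_add, ← add_mul]
    refine Eq.trans ?_ h
    refine tsum_congr fun n => ?_
    rw [← mul_assoc, ← h1]
    rfl
  rw [ENNReal.tsum_mul_left] at h2
  exact (ENNReal.mul_right_inj (by simpa using Real.exp_pos _) ENNReal.ofReal_ne_top).1 h2

/-! ### The Gärtner-Ellis theorem on the real line -/

theorem log_mul_ofReal_exp {b z : ℝ} (hb : 0 < b) {t : ℝ≥0} (ht : 0 < t) :
    ((1 / (t : ℝ) : ℝ) : EReal) * ENNReal.log (ENNReal.ofReal (b * Real.exp (t * z)))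
      = ((Real.log b / t + z : ℝ) : EReal) := by
  have ht' : (t : ℝ) ≠ 0 := by exact_mod_cast ht.ne'
  rw [ENNReal.log_ofReal_of_pos (by positivity), ← EReal.coe_mul,
    Real.log_mul hb.ne' (Real.exp_pos _).ne', Real.log_exp]
  congr 1
  field_simp

theorem tendsto_div_nnreal_add (l z : ℝ) :
    Tendsto (fun t : ℝ≥0 => ((l / t + z : ℝ) : EReal)) atTop (𝓝 z) := by
  have h : Tendsto (fun t : ℝ≥0 => l / (t : ℝ) + z) atTop (𝓝 (0 + z)) :=
    ((NNReal.tendsto_coe_atTop.2 tendsto_id).const_div_atTop l).add_const z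
  rw [zero_add] at h
  exact (continuous_coe_real_ereal.tendsto z).comp h

theorem limsup_log_le_of_le_exp {u : ℝ≥0 → ℝ≥0∞} {b z : ℝ} (hb : 0 < b)
    (h : ∀ᶠ t : ℝ≥0 in atTop, u t ≤ ENNReal.ofReal (b * Real.exp (t * z))) :
    limsup (fun t : ℝ≥0 => ((1 / (t : ℝ) : ℝ) : EReal) * ENNReal.log (u t)) atTop ≤ z := by
  rw [← (tendsto_div_nnreal_add (Real.log b) z).limsup_eq]
  refine limsup_le_limsup ?_
  filter_upwards [h, eventually_gt_atTop 0] with t ht ht0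
  rw [← log_mul_ofReal_exp hb ht0]
  exact mul_le_mul_of_nonneg_left (ENNReal.log_le_log ht) (by positivity)

theorem le_liminf_log_of_exp_le {u : ℝ≥0 → ℝ≥0∞} {b z : ℝ} (hb : 0 < b)
    (h : ∀ᶠ t : ℝ≥0 in atTop, ENNReal.ofReal (b * Real.exp (t * z)) ≤ u t) :
    z ≤ liminf (fun t : ℝ≥0 => ((1 / (t : ℝ) : ℝ) : EReal) * ENNReal.log (u t)) atTop := by
  rw [← (tendsto_div_nnreal_add (Real.log b) z).liminf_eq]
  refine liminf_le_liminf ?_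
  filter_upwards [h, eventually_gt_atTop 0] with t ht ht0
  rw [← log_mul_ofReal_exp hb ht0]
  exact mul_le_mul_of_nonneg_left (ENNReal.log_le_log ht) (by positivity)

/-- The exponential Chebyshev inequality, under an exponential tilting. -/
theorem setLIntegral_exp_le (μ : Measure ℝ) (γ η s : ℝ) {t : ℝ} (ht : 0 ≤ t) :
    ∫⁻ x in {x | s ≤ η * x}, ENNReal.ofReal (Real.exp (γ * (t * x))) ∂μ ≤
      ENNReal.ofReal (Real.exp (-(t * s))) *
        ∫⁻ x, ENNReal.ofReal (Real.exp ((γ + η) * (t * x))) ∂μ := by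
  rw [← lintegral_const_mul _ (by fun_prop)]
  refine le_trans (setLIntegral_mono (by fun_prop) fun x hx => ?_) (setLIntegral_le_lintegral _ _)
  rw [← ENNReal.ofReal_mul (Real.exp_pos _).le, ← Real.exp_add]
  refine ENNReal.ofReal_le_ofReal (Real.exp_le_exp.2 ?_)
  have := mul_le_mul_of_nonneg_left (show s ≤ η * x from hx) ht
  linarith

/-- The moment generating functions of the rescaled laws `π t` equal `exp (t * Λ)` up to constant
factors. -/
def HasScaledLogMgf (π : ℝ≥0 → Measure ℝ) (Λ : ℝ → ℝ) : Prop :=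
  ∀ γ, ∃ a b : ℝ, 0 < a ∧ 0 < b ∧ ∀ t : ℝ≥0, 0 < t →
    ENNReal.ofReal (a * Real.exp (t * Λ γ))
      ≤ ∫⁻ x, ENNReal.ofReal (Real.exp (γ * ((t : ℝ) * x))) ∂π t ∧
    ∫⁻ x, ENNReal.ofReal (Real.exp (γ * ((t : ℝ) * x))) ∂π t
      ≤ ENNReal.ofReal (b * Real.exp (t * Λ γ))

/-! ### Chernoff upper bounds and tilted lower bounds -/

namespace HasScaledLogMgf

variable {π : ℝ≥0 → Measure ℝ} {Λ : ℝ → ℝ}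

/-- At `γ = 0` this is the Chernoff bound; for general `γ` it controls the tails of the law tilted
by `γ`. -/
theorem setLIntegral_le (h : HasScaledLogMgf π Λ) (γ η s : ℝ) :
    ∃ b : ℝ, 0 < b ∧ ∀ t : ℝ≥0, 0 < t →
      ∫⁻ x in {x | s ≤ η * x}, ENNReal.ofReal (Real.exp (γ * ((t : ℝ) * x))) ∂π t
        ≤ ENNReal.ofReal (b * Real.exp (t * (Λ (γ + η) - s))) := by
  obtain ⟨a, b, ha, hb, hab⟩ := h (γ + η)
  refine ⟨b, hb, fun t ht => (setLIntegral_exp_le (π t) γ η s t.coe_nonneg).trans ?_⟩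
  refine (mul_le_mul_right (hab t ht).2 _).trans_eq ?_
  rw [← ENNReal.ofReal_mul (Real.exp_pos _).le, mul_left_comm, ← Real.exp_add]
  congr 3
  ring

theorem measure_lt_le (h : HasScaledLogMgf π Λ) (γ a : ℝ) :
    ∃ b : ℝ, 0 < b ∧ ∀ t : ℝ≥0, 0 < t →
      π t {x | a < γ * x - Λ γ} ≤ ENNReal.ofReal (b * Real.exp (t * -a)) := by
  obtain ⟨b, hb, hb'⟩ := h.setLIntegral_le 0 γ (a + Λ γ)
  refine ⟨b, hb, fun t ht => ?_⟩
  have h1 := hb' t ht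
  simp only [zero_mul, Real.exp_zero, ENNReal.ofReal_one, setLIntegral_one, zero_add] at h1
  refine (measure_mono fun x hx => ?_).trans (h1.trans_eq ?_)
  · have : a < γ * x - Λ γ := hx
    simp only [Set.mem_ofPred_eq]
    linarith
  · congr 4
    ring

/-- Each point of `C` lies in an open half-line, or in the whole line, of the form `{x | a < γ * x -
Λ γ}`, to which Chernoff applies. Finitely many such sets suffice on a compact interval, and `γ =
±1` handles its complement. -/
theorem measure_closed_le (h : HasScaledLogMgf π Λ) {C : Set ℝ} (hC : IsClosed C) {a : ℝ}
    (ha : ∀ y ∈ C, (a : EReal) < legendreTransform Λ y) :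
    ∃ b : ℝ, 0 < b ∧ ∀ t : ℝ≥0, 0 < t →
      π t C ≤ ENNReal.ofReal (b * Real.exp (t * -a)) := by
  set Q : Set ℝ → Prop := fun S => ∃ b : ℝ, 0 < b ∧ ∀ t : ℝ≥0, 0 < t →
      π t S ≤ ENNReal.ofReal (b * Real.exp (t * -a))
  have hmono : ∀ ⦃s t : Set ℝ⦄, s ⊆ t → Q t → Q s := fun s t hst ⟨b, hb, hb'⟩ =>
    ⟨b, hb, fun τ hτ => (measure_mono hst).trans (hb' τ hτ)⟩
  have hunion : ∀ ⦃s t : Set ℝ⦄, Q s → Q t → Q (s ∪ t) := by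
    rintro s t ⟨b, hb, hb'⟩ ⟨c, hc, hc'⟩
    refine ⟨b + c, by positivity, fun τ hτ => (measure_union_le s t).trans ?_⟩
    rw [add_mul, ENNReal.ofReal_add (by positivity) (by positivity)]
    exact add_le_add (hb' τ hτ) (hc' τ hτ)
  have hopen : ∀ γ, IsOpen {x | a < γ * x - Λ γ} := fun γ =>
    isOpen_lt (by fun_prop) (by fun_prop)
  have hcompact : Q (C ∩ Set.Icc (-(a + Λ (-1))) (a + Λ 1)) := by
    refine (isCompact_Icc.inter_left hC).induction_on ⟨1, one_pos, fun τ _ => by simp⟩ hmono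
      hunion fun y hy => ?_
    obtain ⟨γ, hγ⟩ := lt_iSup_iff.1 (ha y hy.1)
    refine ⟨{x | a < γ * x - Λ γ}, mem_nhdsWithin_of_mem_nhds ((hopen γ).mem_nhds ?_),
      h.measure_lt_le γ a⟩
    exact EReal.coe_lt_coe_iff.1 hγ
  refine hmono ?_ (hunion hcompact (hunion (h.measure_lt_le 1 a) (h.measure_lt_le (-1) a)))
  intro y hy
  simp only [Set.mem_union, Set.mem_inter_iff, Set.mem_Icc, Set.mem_ofPred_eq]
  by_cases h1 : y ≤ a + Λ 1
  · by_cases h2 : -(a + Λ (-1)) ≤ y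
    · exact Or.inl ⟨hy, h2, h1⟩
    · right; right; linarith
  · right; left; linarith

/-- Under the tilt by `γ` the law concentrates near `y = Λ' γ`, and undoing the tilt on the ball
costs at most `exp (t * (γ * y + |γ| * δ))`. -/
theorem exists_exp_le_measure_ball (h : HasScaledLogMgf π Λ)
    (hπ : ∀ t, 0 < t → IsProbabilityMeasure (π t)) {γ y δ : ℝ} (hδ : 0 < δ)
    (hγ : HasDerivAt Λ y γ) :
    ∃ b : ℝ, 0 < b ∧ ∀ᶠ t : ℝ≥0 in atTop,
      ENNReal.ofReal (b * Real.exp (t * (-(γ * y - Λ γ) - |γ| * δ)))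
        ≤ π t (Metric.ball y δ) := by
  -- The factor `δ / 2` beats the tail threshold `η * δ`: both tilted tails decay strictly faster
  -- than `exp (t * Λ γ)`, as recorded by `hκ₁` and `hκ₂`.
  have hsmall : ∀ᶠ ε in 𝓝 (0 : ℝ), |Λ (γ + ε) - Λ γ - ε * y| ≤ δ / 2 * |ε| := by
    have := (hasDerivAt_iff_isLittleO_nhds_zero.1 hγ).def (half_pos hδ)
    simpa [Real.norm_eq_abs] using this
  obtain ⟨r, hr, hball⟩ := Metric.eventually_nhds_iff.1 hsmall
  obtain ⟨η, hη0, hηr⟩ := exists_between hr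
  have h1 := (abs_le.1 (hball (y := η) (by simpa [abs_of_pos hη0] using hηr))).2
  have h2 := (abs_le.1 (hball (y := -η) (by simpa [abs_of_pos hη0] using hηr))).2
  rw [abs_of_pos hη0] at h1
  rw [abs_neg, abs_of_pos hη0] at h2
  have hpos : 0 < η * δ := mul_pos hη0 hδ
  obtain ⟨a, b, ha, hb, hab⟩ := h γ
  obtain ⟨b₁, hb₁, hb₁'⟩ := h.setLIntegral_le γ η (η * y + η * δ)
  obtain ⟨b₂, hb₂, hb₂'⟩ := h.setLIntegral_le γ (-η) (-η * y + η * δ)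
  set κ₁ := Λ (γ + η) - (η * y + η * δ)
  set κ₂ := Λ (γ + -η) - (-η * y + η * δ)
  have hκ₁ : κ₁ - Λ γ < 0 := by simp only [κ₁]; linarith
  have hκ₂ : κ₂ - Λ γ < 0 := by simp only [κ₂]; linarith
  have hlim : ∀ (b : ℝ) {κ : ℝ}, κ < 0 →
      Tendsto (fun t : ℝ≥0 => b * Real.exp (t * κ)) atTop (𝓝 0) := by
    intro b κ hκ
    have := (Real.tendsto_exp_atBot.comp
      ((NNReal.tendsto_coe_atTop.2 tendsto_id).atTop_mul_const_of_neg hκ)).const_mul b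
    simpa using this
  have hlim' := (hlim b₁ hκ₁).add (hlim b₂ hκ₂)
  rw [add_zero] at hlim'
  -- For large `t` the two tails use up less than half of the lower bound `a * exp (t * Λ γ)`.
  refine ⟨a / 2, half_pos ha, ?_⟩
  filter_upwards [hlim'.eventually_lt_const (half_pos ha), eventually_gt_atTop 0] with t ht ht0
  have := hπ t ht0
  set q := (π t).real (Metric.ball y δ)
  have hq : π t (Metric.ball y δ) = ENNReal.ofReal q := by simp [q]
  have hcover : (Set.univ : Set ℝ) ⊆ Metric.ball y δ ∪
      ({x | η * y + η * δ ≤ η * x} ∪ {x | -η * y + η * δ ≤ -η * x}) := by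
    intro x _
    simp only [Set.mem_union, Metric.mem_ball, Real.dist_eq, Set.mem_ofPred_eq, abs_lt]
    by_cases hx : y + δ ≤ x
    · right; left
      have := mul_le_mul_of_nonneg_left hx hη0.le
      linarith
    · by_cases hx' : x ≤ y - δ
      · right; right
        have := mul_le_mul_of_nonneg_left hx' hη0.le
        linarith
      · left; constructor <;> linarith
  have hballint : ∫⁻ x in Metric.ball y δ, ENNReal.ofReal (Real.exp (γ * ((t : ℝ) * x))) ∂π t
      ≤ ENNReal.ofReal (Real.exp (t * (γ * y + |γ| * δ)) * q) := by
    rw [ENNReal.ofReal_mul (Real.exp_pos _).le, ← hq, ← setLIntegral_const]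
    refine setLIntegral_mono (by fun_prop) fun x hx => ?_
    refine ENNReal.ofReal_le_ofReal (Real.exp_le_exp.2 ?_)
    rw [mul_left_comm]
    refine mul_le_mul_of_nonneg_left ?_ t.2
    have h3 : γ * (x - y) ≤ |γ| * δ := by
      refine (le_abs_self _).trans ?_
      rw [abs_mul]
      exact mul_le_mul_of_nonneg_left (Metric.mem_ball.1 hx).le (abs_nonneg γ)
    linarith
  have hmain := (hab t ht0).1
  rw [← setLIntegral_univ] at hmain
  have hmain' := hmain.trans ((lintegral_mono_set hcover).trans ((lintegral_union_le _ _ _).trans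
    (add_le_add hballint ((lintegral_union_le _ _ _).trans
      (add_le_add (hb₁' t ht0) (hb₂' t ht0))))))
  have hq0 : 0 ≤ q := measureReal_nonneg
  rw [← ENNReal.ofReal_add (by positivity) (by positivity),
    ← ENNReal.ofReal_add (by positivity) (by positivity),
    ENNReal.ofReal_le_ofReal_iff (by positivity)] at hmain'
  rw [hq]
  refine ENNReal.ofReal_le_ofReal ?_
  have e1 : ∀ κ : ℝ, Real.exp (t * κ) = Real.exp (t * Λ γ) * Real.exp (t * (κ - Λ γ)) := fun κ => by
    rw [← Real.exp_add]; ring_nf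
  rw [e1 κ₁, e1 κ₂] at hmain'
  have e2 : Real.exp (t * (-(γ * y - Λ γ) - |γ| * δ)) =
      Real.exp (t * Λ γ) * Real.exp (-(t * (γ * y + |γ| * δ))) := by
    rw [← Real.exp_add]; ring_nf
  have h4 : a / 2 * Real.exp (t * Λ γ) ≤ Real.exp (t * (γ * y + |γ| * δ)) * q := by
    have := mul_le_mul_of_nonneg_left ht.le (Real.exp_pos (t * Λ γ)).le
    linarith
  have h5 := mul_le_mul_of_nonneg_left h4 (Real.exp_pos (-(t * (γ * y + |γ| * δ)))).le
  rw [← mul_assoc (Real.exp _) (Real.exp _) q, ← Real.exp_add, neg_add_cancel, Real.exp_zero,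
    one_mul] at h5
  rw [e2]
  linarith

end HasScaledLogMgf

/-! ### Legendre transforms and assembly of the two bounds -/

theorem lowerSemicontinuous_legendreTransform (Λ : ℝ → ℝ) :
    LowerSemicontinuous (legendreTransform Λ) := by
  refine lowerSemicontinuous_iSup fun γ => Continuous.lowerSemicontinuous ?_
  exact continuous_coe_real_ereal.comp (by fun_prop)

theorem le_legendreTransform (Λ : ℝ → ℝ) (γ y : ℝ) :
    ((γ * y - Λ γ : ℝ) : EReal) ≤ legendreTransform Λ y :=
  le_iSup (fun γ : ℝ => ((γ * y - Λ γ : ℝ) : EReal)) γ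

theorem isGoodRateFunction_legendreTransform (Λ : ℝ → ℝ) :
    IsGoodRateFunction (legendreTransform Λ) := by
  intro η _
  refine (isCompact_Icc (a := -(η + Λ (-1))) (b := η + Λ 1)).of_isClosed_subset
    ((lowerSemicontinuous_legendreTransform Λ).isClosed_preimage η) fun y hy => ?_
  have h1 := EReal.coe_le_coe_iff.1 ((le_legendreTransform Λ 1 y).trans hy)
  have h2 := EReal.coe_le_coe_iff.1 ((le_legendreTransform Λ (-1) y).trans hy)
  constructor <;> linarith

/-- A version of the Gärtner-Ellis theorem on the real line. -/
theorem HasScaledLogMgf.largeDeviationPrinciple {π : ℝ≥0 → Measure ℝ} {Λ : ℝ → ℝ}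
    (h : HasScaledLogMgf π Λ) (hπ : ∀ t, 0 < t → IsProbabilityMeasure (π t))
    (hdiff : Differentiable ℝ Λ) (hzero : Λ 0 = 0)
    (hco : ∀ y, Tendsto (fun γ => Λ γ - γ * y) (cocompact ℝ) atTop) :
    LargeDeviationPrinciple π (fun t => (t : ℝ)) (legendreTransform Λ) where
  isProbabilityMeasure := hπ
  speed_tendsto := NNReal.tendsto_coe_atTop.2 tendsto_id
  rate_nonneg y := by simpa [hzero] using le_legendreTransform Λ 0 y
  rate_lsc := lowerSemicontinuous_legendreTransform Λ
  lower_bound O hO := by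
    refine EReal.neg_le_of_neg_le (le_iInf₂ fun y hy => EReal.neg_le_of_neg_le ?_)
    -- Coercivity gives a minimiser of `Λ γ - γ * y`, and there `Λ' γ = y`. No convexity of `Λ` is
    -- needed.
    have hcont : Continuous fun γ => Λ γ - γ * y := hdiff.continuous.sub (by fun_prop)
    obtain ⟨γ, hγ⟩ := hcont.exists_forall_le (hco y)
    have hderiv : HasDerivAt Λ y γ := by
      have h1 := (hdiff γ).hasDerivAt.sub ((hasDerivAt_id γ).mul_const y)
      have h2 := IsLocalMin.hasDerivAt_eq_zero (Filter.Eventually.of_forall hγ) h1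
      rw [one_mul, sub_eq_zero] at h2
      exact h2 ▸ (hdiff γ).hasDerivAt
    refine (EReal.neg_le_neg_iff.2 (le_legendreTransform Λ γ y)).trans ?_
    rw [← EReal.coe_neg]
    refine EReal.ge_of_forall_gt_iff_ge.1 fun z hz => ?_
    have hz' : 0 < -(γ * y - Λ γ) - z := sub_pos.2 (EReal.coe_lt_coe_iff.1 hz)
    obtain ⟨r, hr, hrO⟩ := Metric.isOpen_iff.1 hO y hy
    obtain ⟨δ, hδ, hδr, hδz⟩ : ∃ δ, 0 < δ ∧ δ ≤ r ∧ |γ| * δ ≤ -(γ * y - Λ γ) - z := by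
      refine ⟨min r ((-(γ * y - Λ γ) - z) / (|γ| + 1)), lt_min hr (by positivity),
        min_le_left _ _, ?_⟩
      calc |γ| * min r ((-(γ * y - Λ γ) - z) / (|γ| + 1))
          ≤ (|γ| + 1) * ((-(γ * y - Λ γ) - z) / (|γ| + 1)) := by
            gcongr
            · linarith
            · exact min_le_right _ _
        _ = _ := by field_simp
    obtain ⟨b, hb, hle⟩ := h.exists_exp_le_measure_ball hπ hδ hderiv
    refine le_trans (EReal.coe_le_coe_iff.2 (by linarith)) (le_liminf_log_of_exp_le hb
      (hle.mono fun t ht => ht.trans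
        (measure_mono ((Metric.ball_subset_ball hδr).trans hrO))))
  upper_bound C hC := by
    refine EReal.le_neg_of_le_neg (EReal.ge_of_forall_gt_iff_ge.1 fun a ha => ?_)
    obtain ⟨b, hb, hle⟩ := h.measure_closed_le hC fun y hy =>
      ha.trans_le (iInf₂_le y hy)
    refine EReal.le_neg_of_le_neg ?_
    rw [← EReal.coe_neg]
    exact limsup_log_le_of_le_exp hb ((eventually_gt_atTop 0).mono hle)

/-! ### The function `Λ` of the chain with alternating rates -/

section AlternatingLambda

variable {α₁ α₂ β₁ β₂ : ℝ}

theorem alternatingHTilde_pos (hα₁ : 0 < α₁) (hα₂ : 0 < α₂) (hβ₁ : 0 < β₁) (hβ₂ : 0 < β₂) (z : ℝ) :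
    0 < alternatingHTilde α₁ α₂ β₁ β₂ z := by
  unfold alternatingHTilde
  positivity

theorem differentiable_alternatingLambda (hα₁ : 0 < α₁) (hα₂ : 0 < α₂) (hβ₁ : 0 < β₁)
    (hβ₂ : 0 < β₂) : Differentiable ℝ (alternatingLambda α₁ α₂ β₁ β₂) := by
  have h1 : Differentiable ℝ fun γ => alternatingHTilde α₁ α₂ β₁ β₂ (Real.exp γ) := by
    unfold alternatingHTilde
    fun_prop
  have h2 : Differentiable ℝ fun γ => √(alternatingHTilde α₁ α₂ β₁ β₂ (Real.exp γ)) :=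
    h1.sqrt fun γ => (alternatingHTilde_pos hα₁ hα₂ hβ₁ hβ₂ _).ne'
  unfold alternatingLambda alternatingH
  exact ((h2.const_mul _).div Real.differentiable_exp fun γ => (Real.exp_pos γ).ne').sub_const _

/-- Absorbing the denominator into the root makes visible the discriminant of the characteristic
equation. -/
theorem alternatingLambda_eq (γ : ℝ) :
    alternatingLambda α₁ α₂ β₁ β₂ γ = 1 / 2 * √((α₁ + α₂ - (β₁ + β₂)) ^ 2 +
      4 * ((β₁ * Real.exp γ + β₂ * Real.exp (-γ)) * (α₁ * Real.exp γ + α₂ * Real.exp (-γ))))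
      - (α₁ + α₂ + β₁ + β₂) / 2 := by
  have hpos := Real.exp_pos γ
  unfold alternatingLambda alternatingH
  congr 1
  rw [mul_div_assoc]
  congr 1
  rw [div_eq_iff hpos.ne']
  nth_rewrite 4 [← Real.sqrt_sq hpos.le]
  rw [← Real.sqrt_mul' _ (sq_nonneg _)]
  congr 1
  unfold alternatingHTilde
  rw [Real.exp_neg]
  field_simp

theorem alternatingLambda_zero (hα₁ : 0 < α₁) (hα₂ : 0 < α₂) (hβ₁ : 0 < β₁) (hβ₂ : 0 < β₂) :
    alternatingLambda α₁ α₂ β₁ β₂ 0 = 0 := by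
  rw [alternatingLambda_eq]
  have : (α₁ + α₂ - (β₁ + β₂)) ^ 2 + 4 * ((β₁ * Real.exp 0 + β₂ * Real.exp (-0)) *
      (α₁ * Real.exp 0 + α₂ * Real.exp (-0))) = (α₁ + α₂ + β₁ + β₂) ^ 2 := by
    simp only [neg_zero, Real.exp_zero]
    ring
  rw [this, Real.sqrt_sq (by positivity)]
  ring

/-- The characteristic equation satisfied by `Λ γ`. -/
theorem alternatingLambda_mul (hα₁ : 0 < α₁) (hα₂ : 0 < α₂) (hβ₁ : 0 < β₁) (hβ₂ : 0 < β₂) (γ : ℝ) :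
    (alternatingLambda α₁ α₂ β₁ β₂ γ + (α₁ + α₂)) * (alternatingLambda α₁ α₂ β₁ β₂ γ + (β₁ + β₂)) =
      (β₁ * Real.exp γ + β₂ * Real.exp (-γ)) * (α₁ * Real.exp γ + α₂ * Real.exp (-γ)) := by
  rw [alternatingLambda_eq]
  set D := (β₁ * Real.exp γ + β₂ * Real.exp (-γ)) * (α₁ * Real.exp γ + α₂ * Real.exp (-γ))
  have hD : 0 < D := by positivity
  have := Real.sq_sqrt (show 0 ≤ (α₁ + α₂ - (β₁ + β₂)) ^ 2 + 4 * D by positivity)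
  linarith

/-- This quantity is the odd component of the eigenfunction; it is positive because `Λ γ` is the
larger characteristic root. -/
theorem alternatingLambda_add_pos (hα₁ : 0 < α₁) (hα₂ : 0 < α₂) (hβ₁ : 0 < β₁) (hβ₂ : 0 < β₂)
    (γ : ℝ) : 0 < alternatingLambda α₁ α₂ β₁ β₂ γ + (α₁ + α₂) := by
  rw [alternatingLambda_eq]
  set D := (β₁ * Real.exp γ + β₂ * Real.exp (-γ)) * (α₁ * Real.exp γ + α₂ * Real.exp (-γ))
  have hD : 0 < D := by positivity
  have h1 : |α₁ + α₂ - (β₁ + β₂)| < √((α₁ + α₂ - (β₁ + β₂)) ^ 2 + 4 * D) := by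
    rw [← Real.sqrt_sq_eq_abs]
    exact Real.sqrt_lt_sqrt (sq_nonneg _) (by linarith)
  have := neg_abs_le (α₁ + α₂ - (β₁ + β₂))
  linarith

/-- Any superlinear bound yields coercivity of `Λ γ - γ * y`; a quadratic one follows from `√(4 * D)
≥ 2 * x` and the Taylor bound for the exponential. -/
theorem exists_mul_sq_le_alternatingLambda (hα₁ : 0 < α₁) (hα₂ : 0 < α₂) (hβ₁ : 0 < β₁)
    (hβ₂ : 0 < β₂) : ∃ a b : ℝ, 0 < a ∧ ∀ γ, a * |γ| ^ 2 - b ≤ alternatingLambda α₁ α₂ β₁ β₂ γ := by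
  set m := min (min α₁ α₂) (min β₁ β₂)
  have hm : 0 < m := by simp only [m, lt_min_iff]; exact ⟨⟨hα₁, hα₂⟩, hβ₁, hβ₂⟩
  have h1 : m ≤ α₁ := (min_le_left _ _).trans (min_le_left _ _)
  have h2 : m ≤ α₂ := (min_le_left _ _).trans (min_le_right _ _)
  have h3 : m ≤ β₁ := (min_le_right _ _).trans (min_le_left _ _)
  have h4 : m ≤ β₂ := (min_le_right _ _).trans (min_le_right _ _)
  refine ⟨m / 2, (α₁ + α₂ + β₁ + β₂) / 2, half_pos hm, fun γ => ?_⟩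
  rw [alternatingLambda_eq]
  have hE : 1 + |γ| + |γ| ^ 2 / 2 ≤ Real.exp γ + Real.exp (-γ) := by
    refine (Real.quadratic_le_exp_of_nonneg (abs_nonneg γ)).trans ?_
    have := Real.exp_pos γ
    have := Real.exp_pos (-γ)
    rcases abs_choice γ with h | h <;> rw [h] <;> linarith
  have hE' : |γ| ^ 2 / 2 ≤ Real.exp γ + Real.exp (-γ) := by linarith [abs_nonneg γ]
  set x := m * (Real.exp γ + Real.exp (-γ))
  have hx : 0 < x := by positivity
  have hα : x ≤ α₁ * Real.exp γ + α₂ * Real.exp (-γ) := by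
    simp only [x, mul_add]; gcongr
  have hβ : x ≤ β₁ * Real.exp γ + β₂ * Real.exp (-γ) := by
    simp only [x, mul_add]; gcongr
  have hsqrt : 2 * x ≤ √((α₁ + α₂ - (β₁ + β₂)) ^ 2 +
      4 * ((β₁ * Real.exp γ + β₂ * Real.exp (-γ)) * (α₁ * Real.exp γ + α₂ * Real.exp (-γ)))) := by
    refine Real.le_sqrt_of_sq_le ?_
    have := mul_le_mul hβ hα hx.le (hx.le.trans hβ)
    have := sq_nonneg (α₁ + α₂ - (β₁ + β₂))
    linarith
  have := mul_le_mul_of_nonneg_left hE' hm.le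
  linarith

theorem tendsto_alternatingLambda_sub (hα₁ : 0 < α₁) (hα₂ : 0 < α₂) (hβ₁ : 0 < β₁) (hβ₂ : 0 < β₂)
    (y : ℝ) :
    Tendsto (fun γ => alternatingLambda α₁ α₂ β₁ β₂ γ - γ * y) (cocompact ℝ) atTop := by
  obtain ⟨a, b, ha, hab⟩ := exists_mul_sq_le_alternatingLambda hα₁ hα₂ hβ₁ hβ₂
  have h1 : Tendsto (fun x : ℝ => x * (a * x - |y|) + -b) atTop atTop := by
    refine tendsto_atTop_add_const_right _ _ (tendsto_id.atTop_mul_atTop₀ ?_)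
    exact tendsto_atTop_add_const_right _ _ (tendsto_id.const_mul_atTop ha)
  refine tendsto_atTop_mono (fun γ => ?_) (h1.comp (tendsto_norm_cocompact_atTop (E := ℝ)))
  have h2 := le_abs_self (γ * y)
  rw [abs_mul] at h2
  have := hab γ
  simp only [Function.comp, Real.norm_eq_abs]
  linarith

end AlternatingLambda

/-! ### The eigenfunctions of the generator with alternating rates -/

section Eigenfunction

variable {α₁ α₂ β₁ β₂ : ℝ}

/-- The positive eigenfunctions of the generator with alternating rates. -/
noncomputable def alternatingEigenfunction (α₁ α₂ β₁ β₂ γ : ℝ) (n : ℤ) : ℝ :=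
  (if Even n then α₁ * Real.exp γ + α₂ * Real.exp (-γ)
    else alternatingLambda α₁ α₂ β₁ β₂ γ + (α₁ + α₂)) * Real.exp (γ * n)

theorem alternatingGenerator_up (k : ℤ) :
    alternatingGenerator α₁ α₂ β₁ β₂ k (k + 1) = if Even k then α₁ else β₁ := by
  simp [alternatingGenerator]

theorem alternatingGenerator_down (k : ℤ) :
    alternatingGenerator α₁ α₂ β₁ β₂ k (k - 1) = if Even k then α₂ else β₂ := by
  rw [alternatingGenerator, if_neg (by omega), if_pos rfl]

theorem alternatingGenerator_diag (k : ℤ) :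
    alternatingGenerator α₁ α₂ β₁ β₂ k k = if Even k then -(α₁ + α₂) else -(β₁ + β₂) := by
  rw [alternatingGenerator, if_neg (by omega), if_neg (by omega), if_pos rfl]

theorem hasRatesLE_alternatingGenerator (hα₁ : 0 < α₁) (hα₂ : 0 < α₂) (hβ₁ : 0 < β₁)
    (hβ₂ : 0 < β₂) :
    HasRatesLE (alternatingGenerator α₁ α₂ β₁ β₂) (α₁ + α₂ + (β₁ + β₂)) where
  up k := by rw [alternatingGenerator_up]; split_ifs <;> positivity
  down k := by rw [alternatingGenerator_down]; split_ifs <;> positivity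
  diag k := by rw [alternatingGenerator_diag]; split_ifs <;> linarith

theorem alternatingGenerator_mul_eigenfunction (hα₁ : 0 < α₁) (hα₂ : 0 < α₂) (hβ₁ : 0 < β₁)
    (hβ₂ : 0 < β₂) (γ : ℝ) (k : ℤ) :
    alternatingGenerator α₁ α₂ β₁ β₂ k (k + 1) * alternatingEigenfunction α₁ α₂ β₁ β₂ γ (k + 1)
      + alternatingGenerator α₁ α₂ β₁ β₂ k (k - 1) * alternatingEigenfunction α₁ α₂ β₁ β₂ γ (k - 1)
      + alternatingGenerator α₁ α₂ β₁ β₂ k k * alternatingEigenfunction α₁ α₂ β₁ β₂ γ k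
      = alternatingLambda α₁ α₂ β₁ β₂ γ * alternatingEigenfunction α₁ α₂ β₁ β₂ γ k := by
  have h := alternatingLambda_mul hα₁ hα₂ hβ₁ hβ₂ γ
  have e1 : Real.exp (γ * (k + 1 : ℤ)) = Real.exp (γ * k) * Real.exp γ := by
    rw [← Real.exp_add]; push_cast; ring_nf
  have e2 : Real.exp (γ * (k - 1 : ℤ)) = Real.exp (γ * k) * Real.exp (-γ) := by
    rw [← Real.exp_add]; push_cast; ring_nf
  rw [alternatingGenerator_up, alternatingGenerator_down, alternatingGenerator_diag]
  simp only [alternatingEigenfunction, e1, e2]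
  by_cases hk : Even k
  · have hk1 : ¬Even (k + 1) := by simpa [Int.even_add_one] using hk
    have hk2 : ¬Even (k - 1) := by simpa [Int.even_sub_one] using hk
    simp only [if_pos hk, if_neg hk1, if_neg hk2]
    ring
  -- The even rows hold identically by the choice of components; only the odd rows need the
  -- characteristic equation.
  · have hk1 : Even (k + 1) := by simpa [Int.even_add_one] using hk
    have hk2 : Even (k - 1) := by simpa [Int.even_sub_one] using hk
    simp only [if_neg hk, if_pos hk1, if_pos hk2]
    linear_combination (-Real.exp (γ * k)) * h

theorem exists_alternatingEigenfunction_bounds (hα₁ : 0 < α₁) (hα₂ : 0 < α₂) (hβ₁ : 0 < β₁)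
    (hβ₂ : 0 < β₂) (γ : ℝ) : ∃ a b : ℝ, 0 < a ∧ 0 < b ∧ ∀ n : ℤ,
      a * Real.exp (γ * n) ≤ alternatingEigenfunction α₁ α₂ β₁ β₂ γ n ∧
      alternatingEigenfunction α₁ α₂ β₁ β₂ γ n ≤ b * Real.exp (γ * n) := by
  have h1 : 0 < α₁ * Real.exp γ + α₂ * Real.exp (-γ) := by positivity
  have h2 := alternatingLambda_add_pos hα₁ hα₂ hβ₁ hβ₂ γ
  refine ⟨_, _, lt_min h1 h2, lt_max_of_lt_left (c := alternatingLambda α₁ α₂ β₁ β₂ γ + (α₁ + α₂)) h1, fun n => ?_⟩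
  unfold alternatingEigenfunction
  constructor <;> gcongr <;> split_ifs
  · exact min_le_left _ _
  · exact min_le_right _ _
  · exact le_max_left _ _
  · exact le_max_right _ _

/-- Two-sided exponential bounds for the moment generating function of the transition
probabilities. -/
theorem exists_tsum_mul_exp_bounds (hα₁ : 0 < α₁) (hα₂ : 0 < α₂) (hβ₁ : 0 < β₁) (hβ₂ : 0 < β₂)
    {p : ℝ≥0 → ℤ → ℤ → ℝ} (hp : IsTransitionFunction p)
    (hg : HasGenerator p (alternatingGenerator α₁ α₂ β₁ β₂)) (k : ℤ) (γ : ℝ) :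
    ∃ a b : ℝ, 0 < a ∧ 0 < b ∧ ∀ t : ℝ≥0,
      ENNReal.ofReal (a * Real.exp (t * alternatingLambda α₁ α₂ β₁ β₂ γ))
        ≤ ∑' n : ℤ, ENNReal.ofReal (Real.exp (γ * n)) * ENNReal.ofReal (p t k n) ∧
      ∑' n : ℤ, ENNReal.ofReal (Real.exp (γ * n)) * ENNReal.ofReal (p t k n)
        ≤ ENNReal.ofReal (b * Real.exp (t * alternatingLambda α₁ α₂ β₁ β₂ γ)) := by
  obtain ⟨a, b, ha, hb, hab⟩ := exists_alternatingEigenfunction_bounds hα₁ hα₂ hβ₁ hβ₂ γ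
  set f := alternatingEigenfunction α₁ α₂ β₁ β₂ γ
  have hf : ∀ n, 0 < f n := fun n => (by positivity : 0 < a * Real.exp (γ * n)).trans_le (hab n).1
  have hl := alternatingLambda_add_pos hα₁ hα₂ hβ₁ hβ₂ γ
  have hsum : ∀ t : ℝ≥0, ∑' n, ENNReal.ofReal (p t k n) * ENNReal.ofReal (f n)
      = ENNReal.ofReal (Real.exp (alternatingLambda α₁ α₂ β₁ β₂ γ * t) * f k) := fun t =>
    hp.tsum_mul_eigenfunction hg (hasRatesLE_alternatingGenerator hα₁ hα₂ hβ₁ hβ₂) (by positivity)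
      (fun k => by
        rw [alternatingGenerator_up, alternatingGenerator_down, alternatingGenerator_diag]
        split_ifs <;> ring)
      (fun n => (hf n).le) (by linarith)
      (alternatingGenerator_mul_eigenfunction hα₁ hα₂ hβ₁ hβ₂ γ) t k
  refine ⟨f k / b, f k / a, div_pos (hf k) hb, div_pos (hf k) ha, fun t => ⟨?_, ?_⟩⟩
  · have : ENNReal.ofReal (f k / b * Real.exp (t * alternatingLambda α₁ α₂ β₁ β₂ γ)) =
        ENNReal.ofReal b⁻¹ * ENNReal.ofReal (Real.exp (alternatingLambda α₁ α₂ β₁ β₂ γ * t) * f k)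
        := by
      rw [← ENNReal.ofReal_mul (by positivity), mul_comm (t : ℝ)]
      ring_nf
    rw [this, ← hsum, ← ENNReal.tsum_mul_left]
    refine ENNReal.tsum_le_tsum fun n => ?_
    rw [mul_left_comm, mul_comm, ← ENNReal.ofReal_mul (by positivity)]
    gcongr
    rw [inv_mul_le_iff₀ hb]
    exact (hab n).2
  · have : ENNReal.ofReal (f k / a * Real.exp (t * alternatingLambda α₁ α₂ β₁ β₂ γ)) =
        ENNReal.ofReal a⁻¹ * ENNReal.ofReal (Real.exp (alternatingLambda α₁ α₂ β₁ β₂ γ * t) * f k)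
        := by
      rw [← ENNReal.ofReal_mul (by positivity), mul_comm (t : ℝ)]
      ring_nf
    rw [this, ← hsum, ← ENNReal.tsum_mul_left]
    refine ENNReal.tsum_le_tsum fun n => ?_
    rw [mul_left_comm, mul_comm (ENNReal.ofReal (p t k n)),
      ← ENNReal.ofReal_mul (inv_nonneg.2 ha.le)]
    gcongr
    rw [le_inv_mul_iff₀ ha]
    exact (hab n).1

end Eigenfunction

/-! ### The large deviation principle -/

/-- The conditional law of `X t` given `X 0 = k`. -/
theorem IsMarkovChain.cond_apply_eq {Ω : Type*} [MeasurableSpace Ω] {P : Measure Ω}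
    [IsProbabilityMeasure P] {X : ℝ≥0 → Ω → ℤ} {p : ℝ≥0 → ℤ → ℤ → ℝ} (hX : IsMarkovChain P X p)
    {k : ℤ} (hk : P {ω | X 0 ω = k} ≠ 0) (t : ℝ≥0) (n : ℤ) :
    ProbabilityTheory.cond P {ω | X 0 ω = k} {ω | X t ω = n} = ENNReal.ofReal (p t k n) := by
  have hm : MeasurableSet {ω | X 0 ω = k} := hX.measurable 0 (measurableSet_singleton k)
  -- The Markov property with the single observation time 0.
  have h := hX.markov 0 (fun _ => 0) (Subsingleton.strictMono (α := Fin 1) _) (fun _ => k) t n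
  simp only [forall_const, zero_add] at h
  rw [ProbabilityTheory.cond_apply hm, h, ← mul_assoc,
    ENNReal.inv_mul_cancel hk (measure_ne_top _ _), one_mul]

theorem proposition3p2 {Ω : Type*} [MeasurableSpace Ω] (P : Measure Ω) [IsProbabilityMeasure P]
    (α₁ α₂ β₁ β₂ : ℝ) (hα₁ : 0 < α₁) (hα₂ : 0 < α₂) (hβ₁ : 0 < β₁) (hβ₂ : 0 < β₂)
    (p : ℝ≥0 → ℤ → ℤ → ℝ) (hp : IsTransitionFunction p)
    (hg : HasGenerator p (alternatingGenerator α₁ α₂ β₁ β₂))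
    (X : ℝ≥0 → Ω → ℤ) (hX : IsMarkovChain P X p)
    (k : ℤ) (hk : P {ω | X 0 ω = k} ≠ 0) :
    LargeDeviationPrinciple
        (fun t => (ProbabilityTheory.cond P {ω | X 0 ω = k}).map
          (fun ω => (X t ω : ℝ) / (t : ℝ)))
        (fun t => (t : ℝ))
        (legendreTransform (alternatingLambda α₁ α₂ β₁ β₂)) ∧
      IsGoodRateFunction (legendreTransform (alternatingLambda α₁ α₂ β₁ β₂)) := by
  refine ⟨?_, isGoodRateFunction_legendreTransform _⟩
  have hprob := ProbabilityTheory.cond_isProbabilityMeasure hk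
  have hmeas : ∀ t : ℝ≥0, Measurable fun ω => (X t ω : ℝ) / (t : ℝ) := fun t =>
    ((measurable_of_countable fun n : ℤ => (n : ℝ) / (t : ℝ)).comp (hX.measurable t))
  have hmgf : ∀ (γ : ℝ) (t : ℝ≥0), 0 < t →
      ∫⁻ x, ENNReal.ofReal (Real.exp (γ * ((t : ℝ) * x)))
        ∂(ProbabilityTheory.cond P {ω | X 0 ω = k}).map (fun ω => (X t ω : ℝ) / (t : ℝ)) =
      ∑' n : ℤ, ENNReal.ofReal (Real.exp (γ * n)) * ENNReal.ofReal (p t k n) := by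
    intro γ t ht
    have ht' : (t : ℝ) ≠ 0 := by exact_mod_cast ht.ne'
    rw [lintegral_map (by fun_prop) (hmeas t)]
    simp only [mul_div_cancel₀ _ ht']
    rw [← lintegral_map (f := fun n : ℤ => ENNReal.ofReal (Real.exp (γ * n)))
      (measurable_of_countable _) (hX.measurable t), lintegral_countable']
    refine tsum_congr fun n => ?_
    rw [Measure.map_apply (hX.measurable t) (measurableSet_singleton n), ← hX.cond_apply_eq hk t n]
    rfl
  refine HasScaledLogMgf.largeDeviationPrinciple (fun γ => ?_)
    (fun t _ => Measure.isProbabilityMeasure_map (hmeas t).aemeasurable)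
    (differentiable_alternatingLambda hα₁ hα₂ hβ₁ hβ₂)
    (alternatingLambda_zero hα₁ hα₂ hβ₁ hβ₂)
    (tendsto_alternatingLambda_sub hα₁ hα₂ hβ₁ hβ₂)
  obtain ⟨a, b, ha, hb, hab⟩ := exists_tsum_mul_exp_bounds hα₁ hα₂ hβ₁ hβ₂ hp hg k γ
  refine ⟨a, b, ha, hb, fun t ht => ?_⟩
  rw [hmgf γ t ht]
  exact hab t
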